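/- Let $\alpha=(\alpha_n)_{n\ge 0}$ be a bounded sequence of positive real numbers, and let $W_\alpha$ be the weighted shift with weight sequence $\alpha$, i.e. the bounded operator on $\ell^2=\ell^2(\mathbb{Z}_{\ge 0};\mathbb{C})$ with $W_\alpha e_j=\alpha_j e_{j+1}$ for all $j\ge 0$, where $(e_j)_{j\ge 0}$ is the standard basis. Suppose that $W_\alpha$ is completely hyperexpansive, that is, $$\sum_{p=0}^{n}(-1)^p\binom{n}{p}\,{W_\alpha^*}^{p}\,W_\alpha^{p}\le 0\qquad\text{for every integer } n\ge 1.$$ Then the weighted shift with weight sequence $(1/\alpha_n)_{n\ge 0}$ is a bounded operator and is subnormal; moreover it is moment infinitely divisible: for every real $t>0$, the weighted shift with weight sequence $(1/\alpha_n^{t})_{n\ge 0}$ is a bounded operator and is subnormal. Here a bounded operator on a Hilbert space is subnormal if it is unitarily equivalent to the restriction of a normal operator on some Hilbert space to a closed invariant subspace. -/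

import Mathlib

open scoped ENNReal

noncomputable section

/-- The Hilbert space of square-summable complex sequences indexed by `0, 1, 2, …`. -/
abbrev L2 : Type := lp (fun _ : ℕ => ℂ) 2

/-- The coordinates of `W_α x`: `(0, α₀ x₀, α₁ x₁, …)`. -/
def shiftSeq (α : ℕ → ℝ) (x : ℕ → ℂ) : ℕ → ℂ
  | 0 => 0
  | n + 1 => (α n : ℂ) * x n

theorem hasSum_shiftSeq_le {α : ℕ → ℝ} {C : ℝ} (hC : ∀ n, |α n| ≤ C) (x : L2) :
    Summable (fun n => ‖shiftSeq α x n‖ ^ (2 : ℕ)) ∧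
      ∑' n, ‖shiftSeq α x n‖ ^ (2 : ℕ) ≤ C ^ 2 * ∑' n, ‖x n‖ ^ (2 : ℕ) := by
  have hx : Summable (fun n => ‖x n‖ ^ (2 : ℕ)) := by
    simpa using (lp.memℓp x).summable (by norm_num)
  have hle : ∀ n, ‖shiftSeq α x (n + 1)‖ ^ (2 : ℕ) ≤ C ^ 2 * ‖x n‖ ^ (2 : ℕ) := by
    intro n
    simp only [shiftSeq, norm_mul, Complex.norm_real, Real.norm_eq_abs, mul_pow]
    have := hC n
    gcongr
  have hs1 : Summable (fun n => ‖shiftSeq α x (n + 1)‖ ^ (2 : ℕ)) :=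
    Summable.of_nonneg_of_le (fun n => by positivity) hle (hx.mul_left _)
  have hs : Summable (fun n => ‖shiftSeq α x n‖ ^ (2 : ℕ)) :=
    (summable_nat_add_iff (f := fun n => ‖shiftSeq α x n‖ ^ (2 : ℕ)) 1).1 hs1
  refine ⟨hs, ?_⟩
  rw [hs.tsum_eq_zero_add, ← tsum_mul_left]
  simpa [shiftSeq] using hs1.tsum_le_tsum hle (hx.mul_left _)

/-- The unilateral weighted shift `W_α` on `ℓ²` with bounded weight sequence `α`, as a bounded
operator: `W_α (x₀, x₁, …) = (0, α₀ x₀, α₁ x₁, …)`, so that `W_α e_j = α_j e_{j+1}`. -/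
def weightedShift (α : ℕ → ℝ) (hα : BddAbove (Set.range fun n => |α n|)) : L2 →L[ℂ] L2 :=
  LinearMap.mkContinuousOfExistsBound
    { toFun := fun x => ⟨shiftSeq α x, by
        obtain ⟨C, hC⟩ := hα
        have h := (hasSum_shiftSeq_le (fun n => hC ⟨n, rfl⟩) x).1
        exact memℓp_gen (by simpa using h)⟩
      map_add' := fun x y => by
        ext n
        change shiftSeq α (⇑x + ⇑y) n = shiftSeq α x n + shiftSeq α y n
        cases n <;> simp [shiftSeq, mul_add]
      map_smul' := fun c x => by
        ext n
        change shiftSeq α (c • ⇑x) n = c * shiftSeq α x n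
        cases n <;> simp [shiftSeq, mul_left_comm] }
    (by
      obtain ⟨C, hC⟩ := hα
      have hC' : ∀ n, |α n| ≤ C := fun n => hC ⟨n, rfl⟩
      have hC0 : 0 ≤ C := (abs_nonneg _).trans (hC' 0)
      refine ⟨C, fun x => ?_⟩
      have h := (hasSum_shiftSeq_le hC' x).2
      have hn : ∀ y : L2, ‖y‖ ^ (2 : ℕ) = ∑' n, ‖y n‖ ^ (2 : ℕ) := fun y => by
        simpa using lp.norm_rpow_eq_tsum (p := 2) (by norm_num) y
      refine le_of_sq_le_sq ?_ (by positivity)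
      rw [mul_pow, hn, hn]
      exact h)

theorem weightedShift_single (α : ℕ → ℝ) (hα : BddAbove (Set.range fun n => |α n|)) (j : ℕ) :
    weightedShift α hα (lp.single 2 j (1 : ℂ)) = (α j : ℂ) • lp.single 2 (j + 1) (1 : ℂ) := by
  ext n
  change shiftSeq α (lp.single 2 j (1 : ℂ) : L2) n
    = (α j : ℂ) * (lp.single 2 (j + 1) (1 : ℂ) : L2) n
  cases n with
  | zero => simp [shiftSeq]
  | succ n =>
    by_cases h : n = j
    · subst h; simp [shiftSeq]
    · simp [shiftSeq, h]

universe u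

/-- `T` is subnormal: up to unitary equivalence it is the restriction of a normal operator `N` on
a Hilbert space `K` to a closed invariant subspace (the range of the isometry `V`). -/
def IsSubnormalOperator {H : Type u} [NormedAddCommGroup H] [InnerProductSpace ℂ H]
    (T : H →L[ℂ] H) : Prop :=
  ∃ (K : Type u) (_ : NormedAddCommGroup K) (_ : InnerProductSpace ℂ K) (_ : CompleteSpace K)
    (N : K →L[ℂ] K) (V : H →ₗᵢ[ℂ] K), IsStarNormal N ∧ ∀ x, N (V x) = V (T x)

/-- `T` is completely hyperexpansive: `∑_{p=0}^{n} (-1)^p (n choose p) T*^p T^p ≤ 0` for every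
`n ≥ 1`, in the usual order on self-adjoint operators. -/
def IsCompletelyHyperexpansive {H : Type u} [NormedAddCommGroup H] [InnerProductSpace ℂ H]
    [CompleteSpace H] (T : H →L[ℂ] H) : Prop :=
  ∀ n : ℕ, 1 ≤ n →
    ∑ p ∈ Finset.range (n + 1),
      ((-1 : ℂ) ^ p * (n.choose p : ℂ)) • ((ContinuousLinearMap.adjoint T) ^ p * T ^ p) ≤ 0

/-- The weighted shift with weight sequence `α` is a bounded operator and is subnormal. -/
def IsSubnormalShift (α : ℕ → ℝ) : Prop :=
  ∃ hα : BddAbove (Set.range fun n => |α n|), IsSubnormalOperator (weightedShift α hα)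

/-- The weighted shift with positive weight sequence `α` is moment infinitely divisible: for
every real `t > 0` the shift with weights `α_n ^ t` is subnormal. -/
def IsMomentInfinitelyDivisible (α : ℕ → ℝ) : Prop :=
  (∀ n, 0 < α n) ∧ ∀ t : ℝ, 0 < t → IsSubnormalShift (fun n => α n ^ t)

end

/-! Let `γ n = ∏ i < n, α i ^ 2`. Testing complete hyperexpansivity on basis vectors says that `γ`
is completely alternating: its forward difference is completely monotone. A Leibniz argument makes
reciprocals of such sequences completely monotone, Euler's limit then gives `exp (-s γ)`, and the
Gamma integral gives `γ ^ (-t)`, the moment sequence of the shift with weights `(1 / α n) ^ t`.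

To pass from moments to subnormality, Krein–Milman replaces the Hausdorff moment theorem: normalised
completely monotone sequences form a compact convex set whose extreme points are geometric, and
these come from uniform measures on circles. So every such sequence is the moment sequence of a
positive functional on functions on a cylinder; in its GNS space, multiplication by the coordinate
is normal and extends the shift. -/

namespace HyperexpansiveShift

open Filter Topology MeasureTheory
open scoped ComplexOrder InnerProductSpace

/-! ### Iterated differences and completely monotone sequences -/

/-- The backward difference `n ↦ f n - f (n + 1)`. -/
def bdiff (f : ℕ → ℝ) (n : ℕ) : ℝ := f n - f (n + 1)

/-- The iterated backward differences of `f` of order at most `K` are nonnegative. -/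
def MonotoneUpTo (K : ℕ) (f : ℕ → ℝ) : Prop := ∀ k ≤ K, ∀ n, 0 ≤ bdiff^[k] f n

/-- Completely monotone sequences: all iterated backward differences are nonnegative. -/
def CompletelyMonotone (f : ℕ → ℝ) : Prop := ∀ k n, 0 ≤ bdiff^[k] f n

theorem completelyMonotone_iff {f : ℕ → ℝ} : CompletelyMonotone f ↔ ∀ K, MonotoneUpTo K f :=
  ⟨fun h _ k _ n => h k n, fun h k n => h k k le_rfl n⟩

theorem bdiff_iterate_shift (f : ℕ → ℝ) (k n : ℕ) :
    bdiff^[k] (fun n => f (n + 1)) n = bdiff^[k] f (n + 1) := by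
  induction k generalizing f n with
  | zero => rfl
  | succ k ih => exact ih (bdiff f) n

theorem bdiff_iterate_add (f g : ℕ → ℝ) (k : ℕ) :
    bdiff^[k] (f + g) = bdiff^[k] f + bdiff^[k] g := by
  induction k generalizing f g with
  | zero => rfl
  | succ k ih =>
    rw [Function.iterate_succ_apply, Function.iterate_succ_apply, Function.iterate_succ_apply, ← ih]
    congr 1; ext n; simp only [bdiff, Pi.add_apply]; ring

theorem bdiff_iterate_smul (c : ℝ) (f : ℕ → ℝ) (k : ℕ) :
    bdiff^[k] (c • f) = c • bdiff^[k] f := by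
  induction k generalizing f with
  | zero => rfl
  | succ k ih =>
    rw [Function.iterate_succ_apply, Function.iterate_succ_apply, ← ih]
    congr 1; ext n; simp only [bdiff, Pi.smul_apply, smul_eq_mul]; ring

theorem bdiff_iterate_eq_sum (f : ℕ → ℝ) (k n : ℕ) :
    bdiff^[k] f n = ∑ p ∈ Finset.range (k + 1), (-1 : ℝ) ^ p * (k.choose p : ℝ) * f (n + p) := by
  have h : ∀ k, bdiff^[k] f = (-1 : ℝ) ^ k • (fwdDiff 1)^[k] f := by
    intro k
    induction k with
    | zero => simp
    | succ k ih =>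
      rw [Function.iterate_succ_apply', Function.iterate_succ_apply', ih]
      ext n; simp only [bdiff, fwdDiff, Pi.smul_apply, smul_eq_mul]; ring
  rw [h, Pi.smul_apply, fwdDiff_iter_eq_sum_shift, Finset.smul_sum]
  refine Finset.sum_congr rfl fun p hp => ?_
  have hp' : p ≤ k := by simpa [Nat.lt_succ_iff] using hp
  obtain ⟨q, rfl⟩ := Nat.exists_eq_add_of_le hp'
  have hq : (-1 : ℝ) ^ q * (-1) ^ q = 1 := by rw [← mul_pow]; simp
  simp only [Nat.add_sub_cancel_left, smul_eq_mul, zsmul_eq_mul, mul_one]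
  push_cast
  rw [pow_add]
  linear_combination ((-1 : ℝ) ^ p * ((p + q).choose p) * f (n + p)) * hq

namespace MonotoneUpTo

variable {K : ℕ} {f g : ℕ → ℝ}

theorem mono {L : ℕ} (h : MonotoneUpTo K f) (hL : L ≤ K) : MonotoneUpTo L f :=
  fun k hk => h k (hk.trans hL)

theorem succ_iff : MonotoneUpTo (K + 1) f ↔ (∀ n, 0 ≤ f n) ∧ MonotoneUpTo K (bdiff f) := by
  refine ⟨fun h => ⟨h 0 (Nat.zero_le _), fun k hk n => h (k + 1) (by omega) n⟩, ?_⟩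
  rintro ⟨h0, h1⟩ (_ | k) hk n
  · exact h0 n
  · exact h1 k (by omega) n

theorem shift (h : MonotoneUpTo K f) : MonotoneUpTo K (fun n => f (n + 1)) := fun k hk n => by
  rw [bdiff_iterate_shift]; exact h k hk _

theorem add (hf : MonotoneUpTo K f) (hg : MonotoneUpTo K g) : MonotoneUpTo K (f + g) :=
  fun k hk n => by
    rw [bdiff_iterate_add]; exact add_nonneg (hf k hk n) (hg k hk n)

theorem mul (hf : MonotoneUpTo K f) (hg : MonotoneUpTo K g) : MonotoneUpTo K (f * g) := by
  induction K generalizing f g with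
  | zero =>
    intro k hk n
    obtain rfl : k = 0 := by omega
    exact mul_nonneg (hf 0 le_rfl n) (hg 0 le_rfl n)
  | succ K ih =>
    have hf' := succ_iff.1 hf
    have hg' := succ_iff.1 hg
    refine succ_iff.2 ⟨fun n => mul_nonneg (hf'.1 n) (hg'.1 n), ?_⟩
    -- Leibniz rule: every factor on the right is known to order `K`, so the induction closes.
    have : bdiff (f * g) = bdiff f * g + (fun n => f (n + 1)) * bdiff g := by
      ext n; simp only [bdiff, Pi.mul_apply, Pi.add_apply]; ring
    rw [this]
    exact (ih hf'.2 (hg.mono K.le_succ)).add (ih (hf.mono K.le_succ).shift hg'.2)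

end MonotoneUpTo

namespace CompletelyMonotone

theorem mul {f g : ℕ → ℝ} (hf : CompletelyMonotone f) (hg : CompletelyMonotone g) :
    CompletelyMonotone (f * g) :=
  completelyMonotone_iff.2 fun K =>
    (completelyMonotone_iff.1 hf K).mul (completelyMonotone_iff.1 hg K)

theorem smul {f : ℕ → ℝ} (hf : CompletelyMonotone f) {c : ℝ} (hc : 0 ≤ c) :
    CompletelyMonotone (c • f) := fun k n => by
  rw [bdiff_iterate_smul]; exact mul_nonneg hc (hf k n)

theorem add {f g : ℕ → ℝ} (hf : CompletelyMonotone f) (hg : CompletelyMonotone g) :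
    CompletelyMonotone (f + g) := fun k n => by
  rw [bdiff_iterate_add]; exact add_nonneg (hf k n) (hg k n)

theorem shift {f : ℕ → ℝ} (hf : CompletelyMonotone f) :
    CompletelyMonotone (fun n => f (n + 1)) := fun k n => by
  rw [bdiff_iterate_shift]; exact hf k _

protected theorem bdiff {f : ℕ → ℝ} (hf : CompletelyMonotone f) : CompletelyMonotone (bdiff f) :=
  fun k n => hf (k + 1) n

theorem nonneg {f : ℕ → ℝ} (hf : CompletelyMonotone f) (n : ℕ) : 0 ≤ f n := hf 0 n

theorem succ_le {f : ℕ → ℝ} (hf : CompletelyMonotone f) (n : ℕ) : f (n + 1) ≤ f n :=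
  sub_nonneg.1 (hf 1 n)

theorem antitone {f : ℕ → ℝ} (hf : CompletelyMonotone f) : Antitone f :=
  antitone_nat_of_succ_le hf.succ_le

theorem one : CompletelyMonotone 1 := by
  have h : ∀ k, bdiff^[k] (0 : ℕ → ℝ) = 0 := fun k => by
    simpa using bdiff_iterate_smul 0 (0 : ℕ → ℝ) k
  rintro (_ | k) n
  · exact zero_le_one
  · have : bdiff 1 = 0 := by ext n; simp [bdiff]
    rw [Function.iterate_succ_apply, this, h]; rfl

theorem pow {f : ℕ → ℝ} (hf : CompletelyMonotone f) (m : ℕ) : CompletelyMonotone (f ^ m) := by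
  induction m with
  | zero => simpa using one
  | succ m ih => rw [pow_succ]; exact ih.mul hf

end CompletelyMonotone

/-! ### Limits, integrals and negative powers -/

theorem tendsto_bdiff_iterate {ι : Type*} {l : Filter ι} {F : ι → ℕ → ℝ} {f : ℕ → ℝ}
    (h : ∀ n, Tendsto (fun i => F i n) l (𝓝 (f n))) (k n : ℕ) :
    Tendsto (fun i => bdiff^[k] (F i) n) l (𝓝 (bdiff^[k] f n)) := by
  simp only [bdiff_iterate_eq_sum]
  exact tendsto_finsetSum _ fun p _ => (h _).const_mul _

theorem CompletelyMonotone.of_tendsto {ι : Type*} {l : Filter ι} [l.NeBot] {F : ι → ℕ → ℝ}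
    {f : ℕ → ℝ} (hF : ∀ i, CompletelyMonotone (F i))
    (h : ∀ n, Tendsto (fun i => F i n) l (𝓝 (f n))) : CompletelyMonotone f := fun k n =>
  ge_of_tendsto' (tendsto_bdiff_iterate h k n) fun i => hF i k n

theorem CompletelyMonotone.setIntegral {s : Set ℝ} (hs : MeasurableSet s) {F : ℝ → ℕ → ℝ}
    (hF : ∀ x ∈ s, CompletelyMonotone (F x)) (hi : ∀ n, IntegrableOn (fun x => F x n) s) :
    CompletelyMonotone (fun n => ∫ x in s, F x n) := fun k n => by
  have : bdiff^[k] (fun n => ∫ x in s, F x n) n = ∫ x in s, bdiff^[k] (F x) n := by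
    simp only [bdiff_iterate_eq_sum]
    rw [integral_finsetSum _ fun p _ => (hi _).const_mul _]
    simp only [integral_const_mul]
  rw [this]
  exact setIntegral_nonneg hs fun x hx => hF x hx k n

/-- The reciprocal of a positive completely alternating sequence is completely monotone. -/
theorem CompletelyMonotone.inv {ψ : ℕ → ℝ} (hψ : ∀ n, 0 < ψ n)
    (h : CompletelyMonotone (fun n => ψ (n + 1) - ψ n)) :
    CompletelyMonotone (fun n => (ψ n)⁻¹) := by
  refine completelyMonotone_iff.2 fun K => ?_
  induction K with
  | zero =>
    intro k hk n
    obtain rfl : k = 0 := by omega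
    exact (inv_pos.2 (hψ n)).le
  | succ K ih =>
    refine MonotoneUpTo.succ_iff.2 ⟨fun n => (inv_pos.2 (hψ n)).le, ?_⟩
    -- The difference of `1 / ψ` involves `1 / ψ` only undifferenced, so order `K` yields order `K +
    -- 1`. This is why monotonicity is graded by order.
    have : bdiff (fun n => (ψ n)⁻¹)
        = (fun n => ψ (n + 1) - ψ n) * (fun n => (ψ n)⁻¹) * fun n => (ψ (n + 1))⁻¹ := by
      ext n
      have h0 := (hψ n).ne'
      have h1 := (hψ (n + 1)).ne'
      simp only [bdiff, Pi.mul_apply]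
      field_simp
    rw [this]
    exact ((completelyMonotone_iff.1 h K).mul ih).mul ih.shift

/-- Euler's limit `(1 + ψ s / m) ^ (-m) → exp (-ψ s)`: each base is the reciprocal of a completely
alternating sequence. -/
theorem CompletelyMonotone.exp_neg_mul {ψ : ℕ → ℝ} (hψ : ∀ n, 0 < ψ n)
    (h : CompletelyMonotone (fun n => ψ (n + 1) - ψ n)) {s : ℝ} (hs : 0 ≤ s) :
    CompletelyMonotone (fun n => Real.exp (-(ψ n * s))) := by
  have hF : ∀ m : ℕ, CompletelyMonotone ((fun n => (1 + ψ n * s / m)⁻¹) ^ m) := fun m => by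
    refine CompletelyMonotone.pow (CompletelyMonotone.inv (fun n => ?_) ?_) m
    · have := hψ n; positivity
    · convert h.smul (c := s / m) (by positivity) using 1
      ext n; simp only [Pi.smul_apply, smul_eq_mul]; ring
  refine CompletelyMonotone.of_tendsto (l := atTop) hF fun n => ?_
  simp only [Pi.pow_apply, inv_pow, Real.exp_neg]
  exact (Real.tendsto_one_add_div_pow_exp (ψ n * s)).inv₀ (Real.exp_pos _).ne'

theorem CompletelyMonotone.one_div_rpow {ψ : ℕ → ℝ} (hψ : ∀ n, 0 < ψ n)
    (h : CompletelyMonotone (fun n => ψ (n + 1) - ψ n)) {t : ℝ} (ht : 0 < t) :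
    CompletelyMonotone (fun n => (1 / ψ n) ^ t) := by
  have hi : ∀ n, ∫ s in Set.Ioi (0 : ℝ), s ^ (t - 1) * Real.exp (-(ψ n * s))
      = (1 / ψ n) ^ t * Real.Gamma t := fun n => Real.integral_rpow_mul_exp_neg_mul_Ioi ht (hψ n)
  have hG := Real.Gamma_pos_of_pos ht
  have key : CompletelyMonotone
      (fun n => ∫ s in Set.Ioi (0 : ℝ), s ^ (t - 1) * Real.exp (-(ψ n * s))) := by
    refine CompletelyMonotone.setIntegral measurableSet_Ioi (fun s hs => ?_) fun n => ?_
    · exact (CompletelyMonotone.exp_neg_mul hψ h (le_of_lt hs)).smul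
        (Real.rpow_nonneg (le_of_lt hs) (t - 1))
    -- A non-integrable function has integral `0` by convention, whereas this integral is positive.
    · by_contra hc
      have hz := integral_undef hc
      rw [hi n] at hz
      have := Real.rpow_pos_of_pos (one_div_pos.2 (hψ n)) t
      exact (mul_pos this hG).ne' hz
  convert key.smul (inv_pos.2 hG).le using 1
  ext n
  simp only [Pi.smul_apply, smul_eq_mul, hi]
  field_simp

/-! ### Extreme points of the Hausdorff moment sequences -/

/-- The Hausdorff moment sequences, described by monotonicity and normalised at `0`. -/
def hausdorffSet : Set (ℕ → ℝ) := {β | CompletelyMonotone β ∧ β 0 = 1}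

theorem convex_hausdorffSet : Convex ℝ hausdorffSet := by
  rintro f ⟨hf, hf0⟩ g ⟨hg, hg0⟩ a b ha hb hab
  exact ⟨(hf.smul ha).add (hg.smul hb), by simp [hf0, hg0, hab]⟩

theorem isCompact_hausdorffSet : IsCompact hausdorffSet := by
  refine (isCompact_univ_pi fun _ : ℕ => isCompact_Icc (a := (0 : ℝ)) (b := 1)).of_isClosed_subset
    ?_ ?_
  · have : hausdorffSet = (⋂ k, ⋂ n, {β | 0 ≤ bdiff^[k] β n}) ∩ {β | β 0 = 1} := by
      ext β; simp [hausdorffSet, CompletelyMonotone]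
    rw [this]
    refine (isClosed_iInter fun k => isClosed_iInter fun n => ?_).inter
      (isClosed_eq (continuous_apply 0) continuous_const)
    simp only [bdiff_iterate_eq_sum]
    exact isClosed_le continuous_const (by fun_prop)
  · rintro β ⟨hβ, h0⟩ n -
    exact ⟨hβ.nonneg n, h0 ▸ hβ.antitone (Nat.zero_le n)⟩

/-- Extreme points of the set of completely monotone sequences are geometric sequences. -/
theorem exists_eq_pow_of_mem_extremePoints {β : ℕ → ℝ}
    (hβ : β ∈ hausdorffSet.extremePoints ℝ) : ∃ c ∈ Set.Icc (0 : ℝ) 1, ∀ n, β n = c ^ n := by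
  obtain ⟨⟨hm, h0⟩, hext⟩ := hβ
  have h1 : β 1 ≤ 1 := h0 ▸ hm.succ_le 0
  refine ⟨β 1, ⟨hm.nonneg 1, h1⟩, ?_⟩
  rcases (hm.nonneg 1).eq_or_lt with hc | hc
  · rintro (_ | n)
    · simpa using h0
    · rw [← hc, zero_pow n.succ_ne_zero]
      exact le_antisymm (hc ▸ hm.antitone (by omega)) (hm.nonneg _)
  rcases h1.eq_or_lt with hc' | hc'
  · have hd : ∀ n, β (n + 1) = β n := fun n => by
      have h2 : bdiff β n ≤ bdiff β 0 := hm.bdiff.antitone (Nat.zero_le n)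
      have h3 := hm.bdiff.nonneg n
      simp only [bdiff, h0, hc', zero_add] at h2 h3
      linarith
    intro n
    rw [hc', one_pow]
    induction n with
    | zero => exact h0
    | succ n ih => rw [hd, ih]
  · have hA : (β 1)⁻¹ • (fun n => β (n + 1)) ∈ hausdorffSet :=
      ⟨hm.shift.smul (inv_pos.2 hc).le, by simp [hc.ne']⟩
    have hB : (1 - β 1)⁻¹ • bdiff β ∈ hausdorffSet :=
      ⟨hm.bdiff.smul (inv_pos.2 (sub_pos.2 hc')).le, by
        simp [bdiff, h0, (sub_pos.2 hc').ne']⟩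
    -- Since `β n = β (n + 1) + bdiff β n`, normalising both summands gives a convex combination
    -- with weights `β 1` and `1 - β 1`. Extremality forces the shifted sequence to be `β 1 • β`.
    have hseg : β ∈ openSegment ℝ ((β 1)⁻¹ • (fun n => β (n + 1))) ((1 - β 1)⁻¹ • bdiff β) := by
      refine ⟨β 1, 1 - β 1, hc, sub_pos.2 hc', by ring, ?_⟩
      rw [smul_inv_smul₀ hc.ne', smul_inv_smul₀ (sub_pos.2 hc').ne']
      ext n; simp [bdiff]
    have heq := hext hA hB hseg
    intro n
    induction n with
    | zero => simpa using h0
    | succ n ih =>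
      have := congrFun heq n
      simp only [Pi.smul_apply, smul_eq_mul] at this
      rw [pow_succ, ← ih, ← this]
      field_simp

/-! ### Positive functionals representing moment sequences -/

section States

variable {X : Type} [TopologicalSpace X] [CompactSpace X]

/-- Positive contractive functionals on `C(X, ℂ)` for which the powers of `z` are orthogonal. -/
def circularStates (z : C(X, ℂ)) : Set (C(X, ℂ) → ℂ) :=
  {φ | (∀ f g, φ (f + g) = φ f + φ g) ∧ (∀ (c : ℂ) f, φ (c • f) = c * φ f) ∧
    (∀ f, 0 ≤ f → 0 ≤ φ f) ∧ (∀ f, ‖φ f‖ ≤ ‖f‖) ∧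
    ∀ m n : ℕ, m ≠ n → φ (star (z ^ m) * z ^ n) = 0}

/-- Tychonoff, as in Banach–Alaoglu: all conditions are closed for pointwise convergence. -/
theorem isCompact_circularStates (z : C(X, ℂ)) : IsCompact (circularStates z) := by
  refine (isCompact_univ_pi fun f : C(X, ℂ) =>
    isCompact_closedBall (0 : ℂ) ‖f‖).of_isClosed_subset ?_ ?_
  · simp only [circularStates, Set.ofPred_and, Set.ofPred_forall]
    refine IsClosed.inter ?_ (IsClosed.inter ?_ (IsClosed.inter ?_ (IsClosed.inter ?_ ?_)))
    · exact isClosed_iInter fun f => isClosed_iInter fun g => isClosed_eq (by fun_prop) (by fun_prop)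
    · exact isClosed_iInter fun f => isClosed_iInter fun g => isClosed_eq (by fun_prop) (by fun_prop)
    · exact isClosed_iInter fun f => isClosed_iInter fun _ => isClosed_le (by fun_prop) (by fun_prop)
    · exact isClosed_iInter fun f => isClosed_le (by fun_prop) (by fun_prop)
    · exact isClosed_iInter fun f => isClosed_iInter fun g => isClosed_iInter fun _ =>
        isClosed_eq (by fun_prop) (by fun_prop)
  · rintro φ ⟨-, -, -, h, -⟩ f -
    simpa using h f

theorem convex_circularStates (z : C(X, ℂ)) : Convex ℝ (circularStates z) := by
  rintro φ ⟨h1, h2, h3, h4, h5⟩ χ ⟨k1, k2, k3, k4, k5⟩ a b ha hb hab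
  refine ⟨fun f g => ?_, fun c f => ?_, fun f hf => ?_, fun f => ?_, fun m n hmn => ?_⟩
  · simp only [Pi.add_apply, Pi.smul_apply, h1, k1, smul_add]; abel
  · simp only [Pi.add_apply, Pi.smul_apply, h2, k2, Complex.real_smul]; ring
  · simp only [Pi.add_apply, Pi.smul_apply, Complex.real_smul]
    have ha' : (0 : ℂ) ≤ a := by exact_mod_cast ha
    have hb' : (0 : ℂ) ≤ b := by exact_mod_cast hb
    exact add_nonneg (mul_nonneg ha' (h3 f hf)) (mul_nonneg hb' (k3 f hf))
  · simp only [Pi.add_apply, Pi.smul_apply]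
    calc ‖a • φ f + b • χ f‖ ≤ ‖a • φ f‖ + ‖b • χ f‖ := norm_add_le _ _
      _ = a * ‖φ f‖ + b * ‖χ f‖ := by
        rw [norm_smul, norm_smul, Real.norm_of_nonneg ha, Real.norm_of_nonneg hb]
      _ ≤ a * ‖f‖ + b * ‖f‖ := by gcongr <;> [exact h4 f; exact k4 f]
      _ = ‖f‖ := by rw [← add_mul, hab, one_mul]
  · simp only [Pi.add_apply, Pi.smul_apply, h5 m n hmn, k5 m n hmn, smul_zero, add_zero]

/-- If all geometric sequences are moment sequences of circular states, then so are all
completely monotone sequences. -/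
theorem exists_circularState (z : C(X, ℂ))
    (hz : ∀ c ∈ Set.Icc (0 : ℝ) 1, ∃ φ ∈ circularStates z,
      ∀ n : ℕ, (φ (star (z ^ n) * z ^ n)).re = c ^ n)
    {β : ℕ → ℝ} (hβ : CompletelyMonotone β) (h0 : β 0 = 1) :
    ∃ φ ∈ circularStates z, ∀ n : ℕ, (φ (star (z ^ n) * z ^ n)).re = β n := by
  let L : (C(X, ℂ) → ℂ) →ₗ[ℝ] (ℕ → ℝ) :=
    { toFun := fun φ n => (φ (star (z ^ n) * z ^ n)).re
      map_add' := fun _ _ => by ext; simp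
      map_smul' := fun _ _ => by ext; simp }
  have hL : Continuous L := by
    refine continuous_pi fun n => ?_
    exact Complex.continuous_re.comp (continuous_apply _)
  -- The image of the states is compact and convex, so by Krein–Milman it suffices that it contains
  -- the extreme points.
  have hsub : hausdorffSet ⊆ L '' circularStates z := by
    rw [← closure_convexHull_extremePoints isCompact_hausdorffSet convex_hausdorffSet]
    refine closure_minimal (convexHull_min ?_ ((convex_circularStates z).linear_image L))
      ((isCompact_circularStates z).image hL).isClosed
    intro γ hγ
    obtain ⟨c, hc, h⟩ := exists_eq_pow_of_mem_extremePoints hγ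
    obtain ⟨φ, hφ, hφ'⟩ := hz c hc
    exact ⟨φ, hφ, funext fun n => (hφ' n).trans (h n).symm⟩
  obtain ⟨φ, hφ, h⟩ := hsub ⟨hβ, h0⟩
  exact ⟨φ, hφ, fun n => congrFun h n⟩

end States

/-! ### Geometric sequences from circles -/

/-- The function `(s, θ) ↦ s e^{iθ}` on the cylinder. -/
noncomputable def polarCoord : C(unitInterval × UnitAddCircle, ℂ) where
  toFun p := (p.1 : ℝ) * fourier 1 p.2
  continuous_toFun := by fun_prop

theorem star_polarCoord_pow_mul_pow (m n : ℕ) (p : unitInterval × UnitAddCircle) :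
    (star (polarCoord ^ m) * polarCoord ^ n) p
      = ((p.1 : ℝ) : ℂ) ^ (m + n) * fourier ((n : ℤ) - m) p.2 := by
  have hp : ∀ (k : ℕ) (x : UnitAddCircle), (fourier 1 x : ℂ) ^ k = fourier (k : ℤ) x := by
    intro k x
    induction k with
    | zero => simp
    | succ k ih => rw [pow_succ, ih]; push_cast; rw [fourier_add]
  change star ((((p.1 : ℝ) : ℂ) * fourier 1 p.2) ^ m) * (((p.1 : ℝ) : ℂ) * fourier 1 p.2) ^ n = _
  rw [mul_pow, mul_pow, hp, hp, star_mul', sub_eq_neg_add, fourier_add, fourier_neg, pow_add]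
  simp only [star_pow, Complex.star_def, Complex.conj_ofReal]
  ring

theorem integral_fourier (n : ℤ) :
    ∫ θ : UnitAddCircle, fourier n θ ∂AddCircle.haarAddCircle = if n = 0 then 1 else 0 := by
  have h := orthonormal_iff_ite.1 (orthonormal_fourier (T := 1)) 0 n
  rw [ContinuousMap.inner_toLp] at h
  simpa [eq_comm] using h

theorem exists_circularState_pow {c : ℝ} (hc : c ∈ Set.Icc (0 : ℝ) 1) :
    ∃ φ ∈ circularStates polarCoord,
      ∀ n : ℕ, (φ (star (polarCoord ^ n) * polarCoord ^ n)).re = c ^ n := by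
  -- On the circle of radius `√c`, `|z| ^ (2 * n) = c ^ n`; rotation invariance makes distinct
  -- powers of `z` orthogonal.
  let s : unitInterval := ⟨√c, Real.sqrt_nonneg c, Real.sqrt_le_one.2 hc.2⟩
  have hint : ∀ f : C(unitInterval × UnitAddCircle, ℂ),
      Integrable (fun θ => f (s, θ)) (AddCircle.haarAddCircle (T := 1)) := fun f =>
    Continuous.integrable_of_hasCompactSupport (by fun_prop) (HasCompactSupport.of_compactSpace _)
  have hm : ∀ m n : ℕ, ∫ θ, (star (polarCoord ^ m) * polarCoord ^ n) (s, θ)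
      ∂(AddCircle.haarAddCircle (T := 1)) = ((√c : ℝ) : ℂ) ^ (m + n) * if m = n then 1 else 0 := by
    intro m n
    simp only [star_polarCoord_pow_mul_pow]
    rw [integral_const_mul, integral_fourier]
    congr 1
    refine if_congr ?_ rfl rfl
    omega
  refine ⟨fun f => ∫ θ, f (s, θ) ∂(AddCircle.haarAddCircle (T := 1)),
    ⟨fun f g => ?_, fun a f => ?_, fun f hf => ?_, fun f => ?_, fun m n hmn => ?_⟩, fun n => ?_⟩
  · exact integral_add (hint f) (hint g)
  · exact integral_const_mul a _
  · exact integral_nonneg fun θ => hf (s, θ)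
  · refine (norm_integral_le_of_norm_le_const (.of_forall fun θ => f.norm_coe_le_norm (s, θ))).trans ?_
    simp
  · exact (hm m n).trans (by rw [if_neg hmn, mul_zero])
  · refine (congrArg Complex.re (hm n n)).trans ?_
    rw [if_pos rfl, mul_one, ← two_mul, pow_mul, ← Complex.ofReal_pow, Real.sq_sqrt hc.1,
      ← Complex.ofReal_pow, Complex.ofReal_re]

/-! ### From positive functionals to subnormal shifts -/

/-- An operator on `ℓ²` acting as a weighted shift on the basis is subnormal as soon as a normal
operator acts in the same way on an orthonormal sequence. -/
theorem isSubnormalOperator_weightedShift {K : Type} [NormedAddCommGroup K]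
    [InnerProductSpace ℂ K] [CompleteSpace K] {N : K →L[ℂ] K} (hN : IsStarNormal N)
    {w : ℕ → ℝ} (hw : BddAbove (Set.range fun n => |w n|)) {u : ℕ → K} (hu : Orthonormal ℂ u)
    (hNu : ∀ n, N (u n) = (w n : ℂ) • u (n + 1)) :
    IsSubnormalOperator (weightedShift w hw) := by
  let V : L2 →ₗᵢ[ℂ] K := hu.orthogonalFamily.linearIsometry
  have hV : ∀ n (c : ℂ), V (lp.single 2 n c) = c • u n := fun n c => by
    exact hu.orthogonalFamily.linearIsometry_apply_single (i := n) c
  refine ⟨K, inferInstance, inferInstance, inferInstance, N, V, hN, fun x => ?_⟩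
  have key : N ∘L V.toContinuousLinearMap = V.toContinuousLinearMap ∘L weightedShift w hw := by
    refine lp.ext_continuousLinearMap (by norm_num) fun n => ?_
    ext
    change N (V (lp.single 2 n 1)) = V (weightedShift w hw (lp.single 2 n 1))
    rw [weightedShift_single, map_smul, hV, hV, one_smul, one_smul, hNu]
  exact congrArg (fun f => f x) key

/-- The circular state `φ` as a positive linear functional. -/
noncomputable def circularStates.toPositive {X : Type} [TopologicalSpace X] [CompactSpace X] {z : C(X, ℂ)}
    {φ : C(X, ℂ) → ℂ} (hφ : φ ∈ circularStates z) : C(X, ℂ) →ₚ[ℂ] ℂ :=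
  PositiveLinearMap.mk₀ { toFun := φ, map_add' := hφ.1, map_smul' := hφ.2.1 } hφ.2.2.1

/-- A weighted shift whose moment sequence is represented by a circular state is subnormal. -/
theorem isSubnormalOperator_of_circularState {X : Type} [TopologicalSpace X] [CompactSpace X]
    {z : C(X, ℂ)} {φ : C(X, ℂ) → ℂ} (hφ : φ ∈ circularStates z) {β w : ℕ → ℝ}
    (hβ : ∀ n, 0 < β n) (hφβ : ∀ n : ℕ, (φ (star (z ^ n) * z ^ n)).re = β n)
    (hw : ∀ n, 0 ≤ w n) (hwβ : ∀ n, β (n + 1) = w n ^ 2 * β n)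
    (hbdd : BddAbove (Set.range fun n => |w n|)) :
    IsSubnormalOperator (weightedShift w hbdd) := by
  let F := circularStates.toPositive hφ
  let e : ℕ → F.GNS := fun n => ((F.toPreGNS (z ^ n) : F.PreGNS) : F.GNS)
  have hinner : ∀ m n, ⟪e m, e n⟫_ℂ = φ (star (z ^ m) * z ^ n) := fun m n =>
    UniformSpace.Completion.inner_coe _ _
  have hself : ∀ n, ⟪e n, e n⟫_ℂ = β n := fun n => by
    rw [← inner_self_ofReal_re, hinner]
    exact congrArg _ (hφβ n)
  have hstep : ∀ n, F.gnsStarAlgHom z (e n) = e (n + 1) := fun n => by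
    refine (PositiveLinearMap.gnsNonUnitalStarAlgHom_apply_coe F).trans ?_
    change _ = ((F.toPreGNS (z ^ (n + 1)) : F.PreGNS) : F.GNS)
    rw [PositiveLinearMap.leftMulMapPreGNS_apply, pow_succ']
    rfl
  have hs : ∀ n, ((√(β n) : ℝ) : ℂ) ≠ 0 := fun n => by
    exact_mod_cast (Real.sqrt_pos.2 (hβ n)).ne'
  refine isSubnormalOperator_weightedShift (N := F.gnsStarAlgHom z)
    (u := fun n => ((√(β n) : ℝ) : ℂ)⁻¹ • e n) ?_ hbdd ?_ fun n => ?_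
  -- `C(X, ℂ)` is commutative, so its image under a star homomorphism consists of normal operators.
  · exact ⟨by rw [← map_star, commute_iff_eq, ← map_mul, ← map_mul, mul_comm]⟩
  · rw [orthonormal_iff_ite]
    intro m n
    rw [inner_smul_left, inner_smul_right]
    split_ifs with h
    · subst h
      have h2 : (β m : ℂ) = ((√(β m) : ℝ) : ℂ) * ((√(β m) : ℝ) : ℂ) := by
        rw [← Complex.ofReal_mul, Real.mul_self_sqrt (hβ m).le]
      rw [hself, map_inv₀, Complex.conj_ofReal, h2]
      have := hs m
      field_simp
    · rw [hinner, hφ.2.2.2.2 m n h, mul_zero, mul_zero]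
  · have h2 : √(β (n + 1)) = w n * √(β n) := by
      rw [hwβ, Real.sqrt_mul (sq_nonneg _), Real.sqrt_sq (hw n)]
    have hw' : (w n : ℂ) ≠ 0 := fun h0 => hs (n + 1) (by rw [h2, Complex.ofReal_mul, h0, zero_mul])
    have := hs n
    rw [map_smul, hstep, smul_smul, h2, Complex.ofReal_mul]
    congr 1
    field_simp

/-- A weighted shift with completely monotone moment sequence is subnormal. -/
theorem isSubnormalShift_of_completelyMonotone {β w : ℕ → ℝ} (hβ : CompletelyMonotone β)
    (hpos : ∀ n, 0 < β n) (h0 : β 0 = 1) (hw : ∀ n, 0 ≤ w n)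
    (hwβ : ∀ n, β (n + 1) = w n ^ 2 * β n) : IsSubnormalShift w := by
  have hbdd : BddAbove (Set.range fun n => |w n|) := by
    refine ⟨1, ?_⟩
    rintro _ ⟨n, rfl⟩
    have h1 := hβ.succ_le n
    rw [hwβ] at h1
    exact (sq_le_one_iff_abs_le_one _).1 (le_of_mul_le_mul_right (by rwa [one_mul]) (hpos n))
  obtain ⟨φ, hφ, h⟩ := exists_circularState polarCoord (fun c hc => exists_circularState_pow hc) hβ h0
  exact ⟨hbdd, isSubnormalOperator_of_circularState hφ hpos h hw hwβ hbdd⟩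

/-! ### Moments of completely hyperexpansive shifts -/

theorem weightedShift_pow_single (α : ℕ → ℝ) (hα : BddAbove (Set.range fun n => |α n|))
    (j p : ℕ) : (weightedShift α hα ^ p) (lp.single 2 j (1 : ℂ))
      = ((∏ i ∈ Finset.range p, α (j + i) : ℝ) : ℂ) • lp.single 2 (j + p) (1 : ℂ) := by
  induction p with
  | zero => simp
  | succ p ih =>
    rw [pow_succ', mul_apply_eq_comp, ih, map_smul, weightedShift_single, smul_smul,
      Finset.prod_range_succ, Complex.ofReal_mul]
    rfl

/-- The moments of a completely hyperexpansive weighted shift are completely alternating. -/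
theorem completelyMonotone_of_isCompletelyHyperexpansive {α : ℕ → ℝ} (hpos : ∀ n, 0 < α n)
    (hbdd : BddAbove (Set.range fun n => |α n|))
    (hW : IsCompletelyHyperexpansive (weightedShift α hbdd)) :
    CompletelyMonotone (fun n => ∏ i ∈ Finset.range (n + 1), α i ^ 2
      - ∏ i ∈ Finset.range n, α i ^ 2) := by
  set γ : ℕ → ℝ := fun n => ∏ i ∈ Finset.range n, α i ^ 2 with hγ
  have hγpos : ∀ n, 0 < γ n := fun n => Finset.prod_pos fun i _ => pow_pos (hpos i) 2
  set T := weightedShift α hbdd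
  have hnorm : ∀ j p, ‖(T ^ p) (lp.single 2 j (1 : ℂ))‖ ^ 2 = γ (j + p) / γ j := fun j p => by
    have h1 : ‖(lp.single 2 (j + p) (1 : ℂ) : L2)‖ = 1 := by
      rw [lp.norm_single (by norm_num)]; simp
    rw [weightedShift_pow_single, norm_smul, h1, mul_one, Complex.norm_real, Real.norm_eq_abs,
      sq_abs, eq_div_iff (hγpos j).ne', ← Finset.prod_pow, hγ, mul_comm]
    exact (Finset.prod_range_add _ j p).symm
  -- The quadratic form of the order `k + 1` inequality at the `j`-th basis vector is `bdiff^[k + 1]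
  -- γ j / γ j`.
  have hneg : ∀ k j, bdiff^[k + 1] γ j ≤ 0 := fun k j => by
    have h := (ContinuousLinearMap.le_def _ _).1 (hW (k + 1) (by omega))
    have h2 := h.re_inner_nonneg_right (lp.single 2 j (1 : ℂ))
    have h3 : ∀ p : ℕ, ⟪(lp.single 2 j (1 : ℂ) : L2),
        ((ContinuousLinearMap.adjoint T) ^ p * T ^ p) (lp.single 2 j (1 : ℂ))⟫_ℂ
          = ((γ (j + p) / γ j : ℝ) : ℂ) := fun p => by
      rw [← ContinuousLinearMap.star_eq_adjoint, ← star_pow, ContinuousLinearMap.star_eq_adjoint,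
        mul_apply_eq_comp, ContinuousLinearMap.adjoint_inner_right,
        inner_self_eq_norm_sq_to_K, ← hnorm]
      simp
    have h4 : ⟪(lp.single 2 j (1 : ℂ) : L2), (0 - ∑ p ∈ Finset.range (k + 1 + 1),
        ((-1 : ℂ) ^ p * ((k + 1).choose p : ℂ)) • ((ContinuousLinearMap.adjoint T) ^ p * T ^ p))
          (lp.single 2 j (1 : ℂ))⟫_ℂ = ((-(bdiff^[k + 1] γ j / γ j) : ℝ) : ℂ) := by
      rw [zero_sub, neg_apply, inner_neg_right, sum_apply,
        inner_sum, bdiff_iterate_eq_sum, Finset.sum_div,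
        Complex.ofReal_neg, Complex.ofReal_sum]
      congr 1
      refine Finset.sum_congr rfl fun p _ => ?_
      rw [smul_apply, inner_smul_right, h3]
      push_cast
      ring
    rw [h4] at h2
    have h5 : 0 ≤ -(bdiff^[k + 1] γ j / γ j) := h2
    by_contra! hc
    have := div_pos hc (hγpos j)
    linarith
  intro k n
  have : (fun n => γ (n + 1) - γ n) = (-1 : ℝ) • bdiff γ := by
    ext n; simp [bdiff]
  change 0 ≤ bdiff^[k] (fun n => γ (n + 1) - γ n) n
  rw [this, bdiff_iterate_smul]
  have := hneg k n
  simpa using this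

end HyperexpansiveShift

open HyperexpansiveShift in
theorem corollary4p1 (α : ℕ → ℝ) (hpos : ∀ n, 0 < α n)
    (hbdd : BddAbove (Set.range fun n => |α n|))
    (hW : IsCompletelyHyperexpansive (weightedShift α hbdd)) :
    IsSubnormalShift (fun n => 1 / α n) ∧
      IsMomentInfinitelyDivisible (fun n => 1 / α n) := by
  have key : ∀ t : ℝ, 0 < t → IsSubnormalShift (fun n => (1 / α n) ^ t) := fun t ht => by
    have hγ : ∀ n, 0 < ∏ i ∈ Finset.range n, α i ^ 2 := fun n =>
      Finset.prod_pos fun i _ => pow_pos (hpos i) 2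
    refine isSubnormalShift_of_completelyMonotone
      (CompletelyMonotone.one_div_rpow hγ
        (completelyMonotone_of_isCompletelyHyperexpansive hpos hbdd hW) ht)
      (fun n => Real.rpow_pos_of_pos (one_div_pos.2 (hγ n)) t) (by simp)
      (fun n => Real.rpow_nonneg (one_div_pos.2 (hpos n)).le t) fun n => ?_
    -- What remains is the recursion identifying `(1 / γ n) ^ t` as the moments of the weights `(1 /
    -- α n) ^ t`.
    have h1 : 0 ≤ 1 / α n := (one_div_pos.2 (hpos n)).le
    rw [← Real.rpow_natCast, ← Real.rpow_mul h1, mul_comm t, Real.rpow_mul h1, ← Real.mul_rpow (by positivity)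
      (one_div_pos.2 (hγ n)).le, Finset.prod_range_succ, Real.rpow_natCast]
    congr 1
    rw [one_div_pow, ← one_div_mul_one_div, mul_comm]
  exact ⟨by simpa using key 1 one_pos, fun n => one_div_pos.2 (hpos n), key⟩
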